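/- Let $N,d\ge 1$ be integers, $\Omega\subset\mathbb{R}^N$ an open set and $q\in[1,\infty)$. Write $\Omega_0\Subset\Omega$ if $\overline{\Omega_0}$ is compact and contained in $\Omega$; $\fint$ denotes the average integral, $B_\rho(x)$ the open Euclidean ball, $u_{B_\rho(x)}:=\fint_{B_\rho(x)}u(z)\,dz$, $\chi_E$ the characteristic function of $E$, and $\mathcal H^s$ the $s$-dimensional Hausdorff measure. A set is called $\mathcal H^s$-$\sigma$-finite if it is a countable union of sets of finite $\mathcal H^s$-measure. (1) Let $r\in(0,\infty)$ with $rq\le N$, and let $u\in L^q_{loc}(\Omega,\mathbb{R}^d)$ satisfy $$\limsup_{\varepsilon\to0^+}\int_{\Omega_0}\fint_{B_1(0)}\chi_{\Omega_0}(x+\varepsilon z)\,\frac{|u(x+\varepsilon z)-u(x)|^q}{\varepsilon^{rq}}\,dz\,dx<\infty\qquad\text{for every open }\Omega_0\Subset\Omega.$$ Then for every sequence $\varepsilon_n>0$ with $\lim_{n\to\infty}\varepsilon_n=0$ there exists an $\mathcal H^{N-rq}$-$\sigma$-finite set $S\subset\Omega$ such that $$\liminf_{n\to\infty}\fint_{B_{\varepsilon_n}(x)}\big|u(z)-u_{B_{\varepsilon_n}(x)}\big|^q\,dz=0\qquad\text{for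 all }x\in\Omega\setminus S.\tag{$*$}$$ (2) Let $u\in BV^q_{loc}(\Omega,\mathbb{R}^d)$, that is, $u\in L^q_{loc}(\Omega,\mathbb{R}^d)$ and, for every open $\Omega_0\Subset\Omega$, $u\in L^q(\Omega_0,\mathbb{R}^d)$ and $$\sup_{\varepsilon\in(0,1)}\int_{\Omega_0}\int_{\Omega_0\cap B_\varepsilon(x)}\frac1{\varepsilon^N}\frac{|u(x)-u(y)|^q}{|x-y|}\,dy\,dx<\infty.$$ Then: (a) for every sequence $\varepsilon_n>0$ with $\lim_{n\to\infty}\varepsilon_n=0$ there exists an $\mathcal H^{N-1}$-$\sigma$-finite set $S\subset\Omega$ such that $(*)$ holds; (b) there exists an $\mathcal H^{N-1}$-$\sigma$-finite Borel set $S$ such that $\liminf_{\varepsilon\to0^+}\fint_{B_\varepsilon(x)}|u(z)-u_{B_\varepsilon(x)}|^q\,dz=0$ for $\mathcal H^{N-1}$-a.e. $x\in\Omega\setminus S$; (c) the restricted approximate discontinuity set $$\mathcal S''_u:=\Big\{x\in\Omega:\ \liminf_{\rho\to0^+}\Big(\inf_{c\in\mathbb{R}^d}\fint_{B_\rho(x)}|u(y)-c|\,dy\Big)=0\text{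 fails}\Big\}$$ is an $\mathcal H^{N-1}$-$\sigma$-finite Borel set. -/

import Mathlib

open MeasureTheory Filter Topology Set
open scoped ENNReal

/-- `Ω₀ ⋐ Ω`: the closure of `Ω₀` is compact and contained in `Ω`. -/
def CompactlyInside {N : ℕ} (Ω₀ Ω : Set (EuclideanSpace ℝ (Fin N))) : Prop :=
  IsCompact (closure Ω₀) ∧ closure Ω₀ ⊆ Ω

/-- `u ∈ L^q_loc(Ω, ℝ^d)`: `u` is in `L^q(K)` for every compact `K ⊆ Ω`. Functions on `Ω` are
represented by functions on the whole space, whose values outside `Ω` play no role. -/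
def MemLqLoc {N d : ℕ} (q : ℝ) (Ω : Set (EuclideanSpace ℝ (Fin N)))
    (u : EuclideanSpace ℝ (Fin N) → EuclideanSpace ℝ (Fin d)) : Prop :=
  ∀ K : Set (EuclideanSpace ℝ (Fin N)), IsCompact K → K ⊆ Ω →
    MemLp u (ENNReal.ofReal q) (volume.restrict K)

/-- `∫_{Ω₀} ⨍_{B_1(0)} χ_{Ω₀}(x + εz) |u(x + εz) - u(x)|^q / ε^{rq} dz dx`. -/
noncomputable def averagedDifference {N d : ℕ} (q r : ℝ) (Ω₀ : Set (EuclideanSpace ℝ (Fin N)))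
    (u : EuclideanSpace ℝ (Fin N) → EuclideanSpace ℝ (Fin d)) (ε : ℝ) : ℝ≥0∞ :=
  ∫⁻ x in Ω₀, ⨍⁻ z in Metric.ball (0 : EuclideanSpace ℝ (Fin N)) 1,
    Ω₀.indicator (fun y => ‖u y - u x‖ₑ ^ q / ENNReal.ofReal (ε ^ (r * q))) (x + ε • z) ∂volume

/-- The Besov `q`-constant
`sup_{0 < ε < 1} ∫_Ω ∫_{Ω ∩ B_ε(x)} ε^{-N} |u(x) - u(y)|^q / |x - y| dy dx`. -/
noncomputable def besovConstant {N d : ℕ} (q : ℝ) (Ω : Set (EuclideanSpace ℝ (Fin N)))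
    (u : EuclideanSpace ℝ (Fin N) → EuclideanSpace ℝ (Fin d)) : ℝ≥0∞ :=
  ⨆ ε ∈ Ioo (0 : ℝ) 1, ∫⁻ x in Ω, ∫⁻ y in Ω ∩ Metric.ball x ε,
    (ENNReal.ofReal (ε ^ N))⁻¹ * (‖u x - u y‖ₑ ^ q / ‖x - y‖ₑ)

/-- `u ∈ BV^q(Ω, ℝ^d)`. -/
def MemBVq {N d : ℕ} (q : ℝ) (Ω : Set (EuclideanSpace ℝ (Fin N)))
    (u : EuclideanSpace ℝ (Fin N) → EuclideanSpace ℝ (Fin d)) : Prop :=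
  MemLp u (ENNReal.ofReal q) (volume.restrict Ω) ∧ besovConstant q Ω u < ∞

/-- `u ∈ BV^q_loc(Ω, ℝ^d)`. -/
def MemBVqLoc {N d : ℕ} (q : ℝ) (Ω : Set (EuclideanSpace ℝ (Fin N)))
    (u : EuclideanSpace ℝ (Fin N) → EuclideanSpace ℝ (Fin d)) : Prop :=
  MemLqLoc q Ω u ∧
    ∀ Ω₀ : Set (EuclideanSpace ℝ (Fin N)), IsOpen Ω₀ → CompactlyInside Ω₀ Ω → MemBVq q Ω₀ u

/-- The mean oscillation `⨍_{B_ρ(x)} |u(z) - u_{B_ρ(x)}|^q dz`, where `u_{B_ρ(x)}` is the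
average of `u` over `B_ρ(x)`. -/
noncomputable def meanOscillation {N d : ℕ} (q : ℝ)
    (u : EuclideanSpace ℝ (Fin N) → EuclideanSpace ℝ (Fin d))
    (x : EuclideanSpace ℝ (Fin N)) (ρ : ℝ) : ℝ≥0∞ :=
  ⨍⁻ z in Metric.ball x ρ, ‖u z - ⨍ w in Metric.ball x ρ, u w‖ₑ ^ q ∂volume

/-- The restricted approximate discontinuity set `S''_u`: the points `x ∈ Ω` at which
`liminf_{ρ → 0⁺} inf_c ⨍_{B_ρ(x)} |u(y) - c| dy = 0` fails. -/
def restrictedDiscontinuitySet {N d : ℕ} (Ω : Set (EuclideanSpace ℝ (Fin N)))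
    (u : EuclideanSpace ℝ (Fin N) → EuclideanSpace ℝ (Fin d)) :
    Set (EuclideanSpace ℝ (Fin N)) :=
  {x ∈ Ω | ¬ liminf (fun ρ : ℝ => ⨅ c : EuclideanSpace ℝ (Fin d),
    ⨍⁻ y in Metric.ball x ρ, ‖u y - c‖ₑ ∂volume) (𝓝[>] 0) = 0}

/-- `S` is `H^s`-`σ`-finite: a countable union of sets of finite `s`-dimensional Hausdorff
measure. -/
def HausdorffSigmaFinite {N : ℕ} (s : ℝ) (S : Set (EuclideanSpace ℝ (Fin N))) : Prop :=
  ∃ A : ℕ → Set (EuclideanSpace ℝ (Fin N)),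
    (∀ i, Measure.hausdorffMeasure s (A i) < ∞) ∧ S = ⋃ i, A i

/-! Fix a compact `K ⊆ Ω`, a level `δ > 0` and an index `m`, and let `A` be the set of points of `K`
whose mean oscillation is at least `δ` at every scale `ε n`, `n ≥ m`. With `ρ = ε n`, Jensen's
inequality bounds the oscillation on a ball of radius `ρ`, times `ρ ^ (N - r * q)`, by the integral
over that ball of the averaged quotient at scale `2ρ` (`meanOscillation_mul_le`). Balls around
`2ρ`-separated points are disjoint, so summing bounds (number of points) `* ρ ^ (N - r * q)`
uniformly for large `n`. A maximal separated subset of `A` gives a cover, hence `A` has finite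
Hausdorff measure (`hausdorffMeasure_lt_top_of_separated_card_le`). The exceptional set is covered
by countably many such `A`.

For `BV^q` take `r = 1 / q`. Parts (b) and (c) use the single sequence `1 / (n + 1)`. -/

/-! ### Averages over balls, Jensen's inequality, and a packing criterion for finite Hausdorff
measure. -/

open Metric in
theorem laverage_ball_comp_add_smul {E : Type*} [NormedAddCommGroup E] [NormedSpace ℝ E]
    [FiniteDimensional ℝ E] [MeasurableSpace E] [BorelSpace E] (μ : Measure E)
    [μ.IsAddHaarMeasure] (f : E → ℝ≥0∞) (x : E) {ρ : ℝ} (hρ : 0 < ρ) :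
    ⨍⁻ z in ball (0 : E) 1, f (x + ρ • z) ∂μ = ⨍⁻ y in ball x ρ, f y ∂μ := by
  -- Changing variables along a measurable embedding requires no measurability of `f`.
  have hemb : MeasurableEmbedding (fun z : E => x + ρ • z) :=
    ((Homeomorph.smulOfNeZero ρ hρ.ne').trans (Homeomorph.addLeft x)).measurableEmbedding
  have hmap : Measure.map (fun z : E => x + ρ • z) μ =
      ENNReal.ofReal |(ρ ^ Module.finrank ℝ E)⁻¹| • μ := by
    have h1 : (fun z : E => x + ρ • z) = (fun z => x + z) ∘ (fun z => ρ • z) := rfl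
    rw [h1, ← Measure.map_map (by fun_prop) (by fun_prop),
      Measure.map_addHaar_smul _ hρ.ne', Measure.map_smul, map_add_left_eq_self]
  have hpre : (fun z : E => x + ρ • z) ⁻¹' ball x ρ = ball 0 1 := by
    ext z
    simp [norm_smul, abs_of_pos hρ, hρ]
  have hc : 0 < ρ ^ Module.finrank ℝ E := by positivity
  have hc' : ENNReal.ofReal (ρ ^ Module.finrank ℝ E) ≠ 0 := by simpa using hc
  have key : ∫⁻ y in ball x ρ, f y ∂(Measure.map (fun z : E => x + ρ • z) μ) =
      ∫⁻ z in ball 0 1, f (x + ρ • z) ∂μ := by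
    rw [hemb.restrict_map, hemb.lintegral_map, hpre]
  rw [hmap, Measure.restrict_smul, lintegral_smul_measure] at key
  rw [setLAverage_eq, setLAverage_eq, Measure.addHaar_ball_of_pos _ x hρ, ← key,
    abs_of_pos (inv_pos.2 hc), ENNReal.ofReal_inv_of_pos hc, smul_eq_mul, div_eq_mul_inv,
    div_eq_mul_inv, ENNReal.mul_inv (Or.inl hc') (Or.inl ENNReal.ofReal_ne_top)]
  ring

/-- Jensen's inequality for the deviation of a vector-valued function from its average. -/
theorem enorm_sub_average_rpow_le {α E : Type*} [MeasurableSpace α] [NormedAddCommGroup E]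
    [NormedSpace ℝ E] [CompleteSpace E] {μ : Measure α} [IsFiniteMeasure μ] [NeZero μ]
    {q : ℝ} (hq : 1 ≤ q) {u : α → E} (hu : Integrable u μ) (c : E) :
    ‖c - ⨍ w, u w ∂μ‖ₑ ^ q ≤ ⨍⁻ w, ‖u w - c‖ₑ ^ q ∂μ := by
  have hq0 : 0 < q := by linarith
  set P : Measure α := (μ univ)⁻¹ • μ with hP
  have : IsProbabilityMeasure P := by
    rw [hP]; infer_instance
  have huP : Integrable u P := hu.smul_measure (by simp [NeZero.ne])
  have h1 : c - ⨍ w, u w ∂μ = - ∫ w, (u w - c) ∂P := by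
    rw [integral_sub huP (integrable_const c)]
    simp [average_eq', hP]
  have h2 : ‖c - ⨍ w, u w ∂μ‖ₑ ≤ eLpNorm' (fun w => u w - c) 1 P := by
    rw [h1, enorm_neg, eLpNorm']
    simpa using enorm_integral_le_lintegral_enorm (μ := P) fun w => u w - c
  have h3 := h2.trans (eLpNorm'_le_eLpNorm'_of_exponent_le one_pos hq P
    (huP.aestronglyMeasurable.sub aestronglyMeasurable_const))
  calc _ ≤ (eLpNorm' (fun w => u w - c) q P) ^ q := by gcongr
    _ = _ := by
      rw [← lintegral_rpow_enorm_eq_rpow_eLpNorm' hq0, laverage_eq']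

open Metric in
/-- If a set cannot contain too many `2ρ`-separated points, for arbitrarily small `ρ`, then its
Hausdorff measure is finite. -/
theorem hausdorffMeasure_lt_top_of_separated_card_le {X : Type*} [MetricSpace X]
    [MeasurableSpace X] [BorelSpace X] {A : Set X} {s : ℝ} (hs : 0 ≤ s) {C : ℝ≥0∞} (hC : C ≠ ∞)
    {ρ : ℕ → ℝ} (hρ : ∀ n, 0 < ρ n) (hlim : Tendsto ρ atTop (𝓝 0))
    (h : ∀ᶠ n in atTop, ∀ t : Finset X, ↑t ⊆ A →
      (↑t : Set X).Pairwise (fun x y => 2 * ρ n ≤ dist x y) →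
      (t.card : ℝ≥0∞) * ENNReal.ofReal (ρ n ^ s) ≤ C) :
    Measure.hausdorffMeasure s A < ∞ := by
  classical
  -- The packing bound holds only eventually; placing it as a premise lets `choose` pick a `t` for
  -- every `n`.
  have hex : ∀ n, ∃ t : Finset X,
      (∀ t : Finset X, ↑t ⊆ A → (↑t : Set X).Pairwise (fun x y => 2 * ρ n ≤ dist x y) →
        (t.card : ℝ≥0∞) * ENNReal.ofReal (ρ n ^ s) ≤ C) →
      (t.card : ℝ≥0∞) * ENNReal.ofReal (ρ n ^ s) ≤ C ∧ A ⊆ ⋃ i : t, ball (i : X) (2 * ρ n) := by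
    intro n
    by_cases hn : ∀ t : Finset X, ↑t ⊆ A →
      (↑t : Set X).Pairwise (fun x y => 2 * ρ n ≤ dist x y) →
        (t.card : ℝ≥0∞) * ENNReal.ofReal (ρ n ^ s) ≤ C
    swap
    · exact ⟨∅, fun h => absurd h hn⟩
    have hpos : 0 < ρ n ^ s := Real.rpow_pos_of_pos (hρ n) s
    have hpos' : ENNReal.ofReal (ρ n ^ s) ≠ 0 := by simpa using hpos
    obtain ⟨M, hM⟩ := ENNReal.exists_nat_gt
      (ENNReal.div_ne_top hC hpos' : C / ENNReal.ofReal (ρ n ^ s) ≠ ∞)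
    let p : ℕ → Prop := fun k => ∃ t : Finset X, ↑t ⊆ A ∧
      (↑t : Set X).Pairwise (fun x y => 2 * ρ n ≤ dist x y) ∧ t.card = k
    have hbd : ∀ k, p k → k ≤ M := by
      rintro k ⟨t, htA, hts, rfl⟩
      have h1 : (t.card : ℝ≥0∞) ≤ C / ENNReal.ofReal (ρ n ^ s) :=
        (ENNReal.le_div_iff_mul_le (Or.inl hpos') (Or.inl ENNReal.ofReal_ne_top)).2 (hn t htA hts)
      exact_mod_cast (h1.trans_lt hM).le
    have h0 : p 0 := ⟨∅, by simp, by simp, rfl⟩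
    -- A separated set of maximal cardinality: a point outside the `2ρ`-balls around it could be
    -- added.
    obtain ⟨t, htA, hts, htc⟩ : p (Nat.findGreatest p M) :=
      Nat.findGreatest_spec (Nat.zero_le M) h0
    refine ⟨t, fun _ => ⟨hn t htA hts, fun a ha => ?_⟩⟩
    by_contra hcon
    simp only [mem_iUnion, mem_ball, Subtype.exists, not_exists, not_lt] at hcon
    have hat : a ∉ t := fun hat => by
      have := hcon a hat
      rw [dist_self] at this
      linarith [hρ n]
    have hp : p (t.card + 1) := by
      refine ⟨insert a t, ?_, ?_, Finset.card_insert_of_notMem hat⟩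
      · rw [Finset.coe_insert]
        exact insert_subset ha htA
      · rw [Finset.coe_insert]
        refine hts.insert fun b hb _ => ⟨hcon b hb, ?_⟩
        rw [dist_comm]
        exact hcon b hb
    have := Nat.le_findGreatest (hbd _ hp) hp
    omega
  choose t ht using hex
  have hr : Tendsto (fun n => ENNReal.ofReal (4 * ρ n)) atTop (𝓝 0) := by
    rw [← ENNReal.ofReal_zero]
    refine ENNReal.tendsto_ofReal ?_
    simpa using hlim.const_mul 4
  have hdiam : ∀ n, ∀ i : t n, ediam (ball (i : X) (2 * ρ n)) ≤ ENNReal.ofReal (4 * ρ n) := by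
    intro n i
    rw [← eball_ofReal]
    refine ediam_eball_le.trans_eq ?_
    rw [show 4 * ρ n = 2 * (2 * ρ n) by ring, ENNReal.ofReal_mul (p := 2) (by norm_num)]
    simp
  have hbound : ∀ᶠ n in atTop, (∑ i : t n, ediam (ball (i : X) (2 * ρ n)) ^ s) ≤
      ENNReal.ofReal (4 ^ s) * C := by
    filter_upwards [h] with n hn
    calc (∑ i : t n, ediam (ball (i : X) (2 * ρ n)) ^ s)
        ≤ ∑ i : t n, ENNReal.ofReal (4 * ρ n) ^ s :=
          Finset.sum_le_sum fun i _ => ENNReal.rpow_le_rpow (hdiam n i) hs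
      _ = (t n).card * ENNReal.ofReal ((4 * ρ n) ^ s) := by
          rw [ENNReal.ofReal_rpow_of_pos (by linarith [hρ n])]
          simp
      _ = ENNReal.ofReal (4 ^ s) * ((t n).card * ENNReal.ofReal (ρ n ^ s)) := by
          rw [Real.mul_rpow (by norm_num) (hρ n).le, ENNReal.ofReal_mul (by positivity)]
          ring
      _ ≤ _ := by gcongr; exact (ht n hn).1
  calc Measure.hausdorffMeasure s A
      ≤ liminf (fun n => ∑ i : t n, ediam (ball (i : X) (2 * ρ n)) ^ s) atTop :=
        Measure.hausdorffMeasure_le_liminf_sum s A _ hr (fun n (i : t n) => ball (i : X) (2 * ρ n))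
          (Eventually.of_forall hdiam) (h.mono fun n hn => (ht n hn).2)
    _ ≤ limsup (fun n => ∑ i : t n, ediam (ball (i : X) (2 * ρ n)) ^ s) atTop :=
        liminf_le_limsup
    _ ≤ ENNReal.ofReal (4 ^ s) * C := limsup_le_of_le (by isBoundedDefault) hbound
    _ < ∞ := ENNReal.mul_lt_top ENNReal.ofReal_lt_top hC.lt_top

/-! ### Mean oscillation against averaged differences. -/

section Oscillation

open Metric

variable {N d : ℕ} {q r : ℝ} {Ω Ω₀ : Set (EuclideanSpace ℝ (Fin N))}
  {u : EuclideanSpace ℝ (Fin N) → EuclideanSpace ℝ (Fin d)}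

theorem volume_ball_pos_euclidean (x : EuclideanSpace ℝ (Fin N)) {ρ : ℝ} (hρ : 0 < ρ) :
    volume (ball x ρ) = ENNReal.ofReal (ρ ^ N) * volume (ball (0 : EuclideanSpace ℝ (Fin N)) 1) := by
  rw [Measure.addHaar_ball_of_pos _ x hρ, finrank_euclideanSpace_fin]

/-- The inner average in `averagedDifference`. -/
noncomputable def averagedQuotient (q r : ℝ) (Ω₀ : Set (EuclideanSpace ℝ (Fin N)))
    (u : EuclideanSpace ℝ (Fin N) → EuclideanSpace ℝ (Fin d)) (ε : ℝ)
    (x : EuclideanSpace ℝ (Fin N)) : ℝ≥0∞ :=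
  ⨍⁻ z in ball (0 : EuclideanSpace ℝ (Fin N)) 1,
    Ω₀.indicator (fun y => ‖u y - u x‖ₑ ^ q / ENNReal.ofReal (ε ^ (r * q))) (x + ε • z) ∂volume

/-- After Jensen, the ball around `x` is enlarged to `ball z (2 * ρ)`, centred at `z`, as the
averaged quotient requires. The volume ratio costs `2 ^ N`, and the indicator is 1 on the smaller
ball. -/
theorem enorm_sub_average_ball_rpow_le (hq : 1 ≤ q) {x z : EuclideanSpace ℝ (Fin N)} {ρ : ℝ}
    (hρ : 0 < ρ) (hu : IntegrableOn u (ball x ρ)) (hsub : ball x ρ ⊆ Ω₀) (hz : z ∈ ball x ρ) :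
    ‖u z - ⨍ w in ball x ρ, u w‖ₑ ^ q ≤
      ENNReal.ofReal (2 ^ N) * ENNReal.ofReal ((2 * ρ) ^ (r * q)) *
        averagedQuotient q r Ω₀ u (2 * ρ) z := by
  have : NeZero (volume.restrict (ball x ρ)) :=
    ⟨by simpa [Measure.restrict_eq_zero] using (measure_ball_pos volume x hρ).ne'⟩
  have : IsFiniteMeasure (volume.restrict (ball x ρ)) :=
    ⟨by simpa using measure_ball_lt_top⟩
  set c := ENNReal.ofReal ((2 * ρ) ^ (r * q)) with hc
  have hc0 : c ≠ 0 := by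
    simpa [hc] using Real.rpow_pos_of_pos (by linarith : 0 < 2 * ρ) (r * q)
  have hct : c ≠ ∞ := ENNReal.ofReal_ne_top
  have hball : ball x ρ ⊆ ball z (2 * ρ) := fun w hw => by
    have h1 := dist_triangle w x z
    rw [mem_ball] at hw hz ⊢
    rw [dist_comm] at hz
    linarith
  have hvol : volume (ball z (2 * ρ)) = ENNReal.ofReal (2 ^ N) * volume (ball x ρ) := by
    rw [volume_ball_pos_euclidean z (by linarith : 0 < 2 * ρ), volume_ball_pos_euclidean x hρ,
      mul_pow, ENNReal.ofReal_mul (by positivity), mul_assoc]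
  have h2 : ENNReal.ofReal (2 ^ N) ≠ 0 := by simp
  have hle : ∫⁻ w in ball x ρ, ‖u w - u z‖ₑ ^ q ≤ c * ∫⁻ w in ball z (2 * ρ),
      Ω₀.indicator (fun y => ‖u y - u z‖ₑ ^ q / c) w := by
    rw [← lintegral_const_mul' _ _ hct]
    refine (setLIntegral_mono' measurableSet_ball fun w hw => ?_).trans
      (lintegral_mono_set hball)
    rw [indicator_of_mem (hsub hw), ENNReal.mul_div_cancel hc0 hct]
  refine (enorm_sub_average_rpow_le hq hu (u z)).trans ?_
  rw [averagedQuotient, laverage_ball_comp_add_smul volume (fun w =>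
      Ω₀.indicator (fun y => ‖u y - u z‖ₑ ^ q / c) w) z (by linarith : 0 < 2 * ρ),
    setLAverage_eq, setLAverage_eq, hvol, div_eq_mul_inv, div_eq_mul_inv,
    ENNReal.mul_inv (Or.inl h2) (Or.inl ENNReal.ofReal_ne_top)]
  calc _ ≤ (c * ∫⁻ w in ball z (2 * ρ), Ω₀.indicator (fun y => ‖u y - u z‖ₑ ^ q / c) w) *
        (volume (ball x ρ))⁻¹ := by gcongr
    _ = (ENNReal.ofReal (2 ^ N) * (ENNReal.ofReal (2 ^ N))⁻¹) *
        ((c * ∫⁻ w in ball z (2 * ρ), Ω₀.indicator (fun y => ‖u y - u z‖ₑ ^ q / c) w) *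
        (volume (ball x ρ))⁻¹) := by
          rw [ENNReal.mul_inv_cancel h2 ENNReal.ofReal_ne_top, one_mul]
    _ = _ := by ring

/-- The constant in the estimate of the mean oscillation by the averaged difference. -/
noncomputable def oscillationConstant (N : ℕ) (q r : ℝ) : ℝ≥0∞ :=
  ENNReal.ofReal (2 ^ N) * ENNReal.ofReal (2 ^ (r * q)) *
    (volume (ball (0 : EuclideanSpace ℝ (Fin N)) 1))⁻¹

theorem oscillationConstant_ne_top : oscillationConstant N q r ≠ ∞ :=
  ENNReal.mul_ne_top (ENNReal.mul_ne_top ENNReal.ofReal_ne_top ENNReal.ofReal_ne_top)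
    (ENNReal.inv_ne_top.2 (measure_ball_pos volume _ one_pos).ne')

theorem meanOscillation_mul_le (hq : 1 ≤ q) {x : EuclideanSpace ℝ (Fin N)} {ρ : ℝ}
    (hρ : 0 < ρ) (hu : IntegrableOn u (ball x ρ)) (hsub : ball x ρ ⊆ Ω₀) :
    meanOscillation q u x ρ * ENNReal.ofReal (ρ ^ (N - r * q)) ≤
      oscillationConstant N q r * ∫⁻ z in ball x ρ, averagedQuotient q r Ω₀ u (2 * ρ) z := by
  have hfin : ENNReal.ofReal (2 ^ N) * ENNReal.ofReal ((2 * ρ) ^ (r * q)) ≠ ∞ :=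
    ENNReal.mul_ne_top ENNReal.ofReal_ne_top ENNReal.ofReal_ne_top
  have h1 : meanOscillation q u x ρ ≤ ENNReal.ofReal (2 ^ N) *
      ENNReal.ofReal ((2 * ρ) ^ (r * q)) *
      (∫⁻ z in ball x ρ, averagedQuotient q r Ω₀ u (2 * ρ) z) * (volume (ball x ρ))⁻¹ := by
    rw [meanOscillation, setLAverage_eq, div_eq_mul_inv, ← lintegral_const_mul' _ _ hfin]
    gcongr ?_ * _
    exact setLIntegral_mono' measurableSet_ball fun z hz =>
      enorm_sub_average_ball_rpow_le hq hρ hu hsub hz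
  have hN : ENNReal.ofReal (ρ ^ N) ≠ 0 := by simpa using pow_pos hρ N
  have h2 : ENNReal.ofReal (ρ ^ (r * q)) * ENNReal.ofReal (ρ ^ (N - r * q)) *
      (ENNReal.ofReal (ρ ^ N))⁻¹ = 1 := by
    rw [← ENNReal.ofReal_mul (by positivity), ← Real.rpow_add hρ, add_sub_cancel,
      Real.rpow_natCast, ENNReal.mul_inv_cancel hN ENNReal.ofReal_ne_top]
  calc _ ≤ _ := mul_le_mul_left h1 _
    _ = (ENNReal.ofReal (ρ ^ (r * q)) * ENNReal.ofReal (ρ ^ (N - r * q)) *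
          (ENNReal.ofReal (ρ ^ N))⁻¹) * (oscillationConstant N q r *
          ∫⁻ z in ball x ρ, averagedQuotient q r Ω₀ u (2 * ρ) z) := by
        rw [oscillationConstant, volume_ball_pos_euclidean x hρ,
          ENNReal.mul_inv (Or.inl hN) (Or.inl ENNReal.ofReal_ne_top),
          Real.mul_rpow (by norm_num) hρ.le, ENNReal.ofReal_mul (by positivity)]
        ring
    _ = _ := by rw [h2, one_mul]

theorem sum_meanOscillation_mul_le (hq : 1 ≤ q) {ρ : ℝ} (hρ : 0 < ρ)
    {t : Finset (EuclideanSpace ℝ (Fin N))}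
    (ht : (t : Set (EuclideanSpace ℝ (Fin N))).Pairwise fun x y => 2 * ρ ≤ dist x y)
    (hu : ∀ x ∈ t, IntegrableOn u (ball x ρ)) (hsub : ∀ x ∈ t, ball x ρ ⊆ Ω₀) :
    (∑ x ∈ t, meanOscillation q u x ρ) * ENNReal.ofReal (ρ ^ (N - r * q)) ≤
      oscillationConstant N q r * averagedDifference q r Ω₀ u (2 * ρ) := by
  rw [Finset.sum_mul]
  refine (Finset.sum_le_sum fun x hx =>
    meanOscillation_mul_le (r := r) hq hρ (hu x hx) (hsub x hx)).trans ?_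
  rw [← Finset.mul_sum]
  gcongr
  -- Disjointness merges the local integrals into one, without any overlap constant.
  rw [← lintegral_biUnion_finset (fun x hx y hy hxy =>
    ball_disjoint_ball (by linarith [ht hx hy hxy])) fun _ _ => measurableSet_ball]
  exact lintegral_mono_set (iUnion₂_subset hsub)

/-- The averaged differences of order `1 / q` are controlled by the Besov constant. -/
theorem averagedDifference_le_besovConstant (hq : 1 ≤ q) (hΩ₀ : IsOpen Ω₀) {ε : ℝ}
    (hε : ε ∈ Ioo (0 : ℝ) 1) :
    averagedDifference q (1 / q) Ω₀ u ε ≤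
      (volume (ball (0 : EuclideanSpace ℝ (Fin N)) 1))⁻¹ * besovConstant q Ω₀ u := by
  have hε0 : 0 < ε := hε.1
  have hv : (volume (ball (0 : EuclideanSpace ℝ (Fin N)) 1))⁻¹ ≠ ∞ :=
    ENNReal.inv_ne_top.2 (measure_ball_pos volume _ one_pos).ne'
  have hN : ENNReal.ofReal (ε ^ N) ≠ 0 := by simpa using pow_pos hε0 N
  refine le_trans ?_ (mul_le_mul_right (le_iSup₂ (f := fun ε (_ : ε ∈ Ioo (0 : ℝ) 1) =>
    ∫⁻ x in Ω₀, ∫⁻ y in Ω₀ ∩ ball x ε,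
      (ENNReal.ofReal (ε ^ N))⁻¹ * (‖u x - u y‖ₑ ^ q / ‖x - y‖ₑ)) ε hε) _)
  rw [averagedDifference, ← lintegral_const_mul' _ _ hv]
  refine lintegral_mono fun x => ?_
  rw [laverage_ball_comp_add_smul volume (fun y => Ω₀.indicator
      (fun y => ‖u y - u x‖ₑ ^ q / ENNReal.ofReal (ε ^ (1 / q * q))) y) x hε0,
    setLAverage_eq, volume_ball_pos_euclidean x hε0, div_eq_mul_inv,
    ENNReal.mul_inv (Or.inl hN) (Or.inl ENNReal.ofReal_ne_top),
    lintegral_indicator hΩ₀.measurableSet, Measure.restrict_restrict hΩ₀.measurableSet,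
    lintegral_const_mul' _ _ (ENNReal.inv_ne_top.2 hN), one_div_mul_cancel (by linarith),
    Real.rpow_one]
  -- Here `r * q = 1`, and `‖x - y‖ < ε` makes the Besov kernel the larger one.
  have hle : ∫⁻ y in Ω₀ ∩ ball x ε, ‖u y - u x‖ₑ ^ q / ENNReal.ofReal ε ≤
      ∫⁻ y in Ω₀ ∩ ball x ε, ‖u x - u y‖ₑ ^ q / ‖x - y‖ₑ := by
    refine setLIntegral_mono' (hΩ₀.measurableSet.inter measurableSet_ball) fun y hy => ?_
    rw [← enorm_neg, neg_sub]
    gcongr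
    rw [← ofReal_norm, ← dist_eq_norm, dist_comm]
    exact ENNReal.ofReal_le_ofReal (mem_ball.1 hy.2).le
  calc _ ≤ _ := mul_le_mul_left hle _
    _ = _ := by ring

theorem limsup_averagedDifference_lt_top (hq : 1 ≤ q) (hΩ₀ : IsOpen Ω₀)
    (h : besovConstant q Ω₀ u < ∞) :
    limsup (fun ε : ℝ => averagedDifference q (1 / q) Ω₀ u ε) (𝓝[>] 0) < ∞ := by
  refine (limsup_le_of_le (by isBoundedDefault) ?_).trans_lt
    (ENNReal.mul_lt_top (ENNReal.inv_lt_top.2 (measure_ball_pos volume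
      (0 : EuclideanSpace ℝ (Fin N)) one_pos)) h)
  filter_upwards [Ioo_mem_nhdsGT one_pos] with ε hε
  exact averagedDifference_le_besovConstant hq hΩ₀ hε

end Oscillation

/-! ### Sigma-finiteness of the exceptional sets. -/

section SigmaFinite

open Metric

variable {N d : ℕ} {q r s : ℝ} {Ω : Set (EuclideanSpace ℝ (Fin N))}
  {u : EuclideanSpace ℝ (Fin N) → EuclideanSpace ℝ (Fin d)}

theorem HausdorffSigmaFinite.mono {S T : Set (EuclideanSpace ℝ (Fin N))}
    (hT : HausdorffSigmaFinite s T) (h : S ⊆ T) : HausdorffSigmaFinite s S := by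
  obtain ⟨A, hA, rfl⟩ := hT
  exact ⟨fun i => S ∩ A i, fun i => (measure_mono inter_subset_right).trans_lt (hA i),
    by rw [← inter_iUnion, inter_eq_left.2 h]⟩

theorem hausdorffSigmaFinite_iUnion {ι : Type*} [Countable ι] [Nonempty ι]
    {A : ι → Set (EuclideanSpace ℝ (Fin N))} (hA : ∀ i, Measure.hausdorffMeasure s (A i) < ∞) :
    HausdorffSigmaFinite s (⋃ i, A i) := by
  obtain ⟨f, hf⟩ := exists_surjective_nat ι
  exact ⟨fun n => A (f n), fun n => hA _, (hf.iUnion_comp A).symm⟩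

theorem HausdorffSigmaFinite.exists_measurable_superset {S : Set (EuclideanSpace ℝ (Fin N))}
    (hS : HausdorffSigmaFinite s S) : ∃ T, S ⊆ T ∧ MeasurableSet T ∧ HausdorffSigmaFinite s T := by
  obtain ⟨A, hA, rfl⟩ := hS
  refine ⟨⋃ i, toMeasurable (Measure.hausdorffMeasure s) (A i),
    iUnion_mono fun i => subset_toMeasurable _ _,
    MeasurableSet.iUnion fun i => measurableSet_toMeasurable _ _,
    hausdorffSigmaFinite_iUnion fun i => ?_⟩
  rw [measure_toMeasurable]
  exact hA i

theorem MemLqLoc.integrableOn (hq : 1 ≤ q) (hu : MemLqLoc q Ω u)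
    {K : Set (EuclideanSpace ℝ (Fin N))} (hK : IsCompact K) (hKΩ : K ⊆ Ω) : IntegrableOn u K := by
  have : IsFiniteMeasure (volume.restrict K) := ⟨by simpa using hK.measure_lt_top⟩
  exact (hu K hK hKΩ).integrable (by simpa using hq)

/-- The part of a compact set where the mean oscillation along `ε` stays above `δ` has finite
Hausdorff measure. -/
theorem hausdorffMeasure_meanOscillation_ge_lt_top (hΩ : IsOpen Ω) (hq : 1 ≤ q) (hrq : r * q ≤ N)
    (hu : MemLqLoc q Ω u)
    (h : ∀ Ω₀ : Set (EuclideanSpace ℝ (Fin N)), IsOpen Ω₀ → CompactlyInside Ω₀ Ω →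
      limsup (fun ε : ℝ => averagedDifference q r Ω₀ u ε) (𝓝[>] 0) < ∞)
    {ε : ℕ → ℝ} (hε : ∀ n, 0 < ε n) (hlim : Tendsto ε atTop (𝓝 0))
    {K : Set (EuclideanSpace ℝ (Fin N))} (hK : IsCompact K) (hKΩ : K ⊆ Ω) {δ : ℝ≥0∞} (hδ : δ ≠ 0)
    (hδ' : δ ≠ ∞) (m : ℕ) :
    Measure.hausdorffMeasure (N - r * q)
      {x ∈ K | ∀ n ≥ m, δ ≤ meanOscillation q u x (ε n)} < ∞ := by
  -- A neighbourhood of `K` that contains all small balls centred in `K` and on whose closure `u` is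
  -- integrable.
  obtain ⟨Ω₀, hΩ₀, hKΩ₀, hclΩ, hcl⟩ := exists_open_between_and_isCompact_closure hK hΩ hKΩ
  obtain ⟨η, hη, hthick⟩ := hK.exists_thickening_subset_open hΩ₀ hKΩ₀
  obtain ⟨M, hM, hMtop⟩ := exists_between (h Ω₀ hΩ₀ ⟨hcl, hclΩ⟩)
  have hlim2 : Tendsto (fun n => 2 * ε n) atTop (𝓝[>] 0) := by
    refine tendsto_nhdsWithin_iff.2 ⟨by simpa using hlim.const_mul 2, ?_⟩
    exact Eventually.of_forall fun n => by simpa using hε n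
  have hev := hlim2.eventually (eventually_lt_of_limsup_lt hM)
  refine hausdorffMeasure_lt_top_of_separated_card_le (sub_nonneg.2 hrq)
    (C := δ⁻¹ * (oscillationConstant N q r * M))
    (ENNReal.mul_ne_top (ENNReal.inv_ne_top.2 hδ)
      (ENNReal.mul_ne_top oscillationConstant_ne_top hMtop.ne)) hε hlim ?_
  filter_upwards [hev, hlim.eventually (gt_mem_nhds hη), eventually_ge_atTop m] with
    n hnM hnη hnm t htA ht
  have hsub : ∀ x ∈ t, ball x (ε n) ⊆ Ω₀ := fun x hx =>
    (ball_subset_ball hnη.le).trans ((ball_subset_thickening (htA hx).1 η).trans hthick)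
  have hint : ∀ x ∈ t, IntegrableOn u (ball x (ε n)) := fun x hx =>
    (hu.integrableOn hq hcl hclΩ).mono_set ((hsub x hx).trans subset_closure)
  have hcard : (t.card : ℝ≥0∞) * δ ≤ ∑ x ∈ t, meanOscillation q u x (ε n) := by
    rw [← nsmul_eq_mul]
    exact Finset.card_nsmul_le_sum _ _ _ fun x hx => (htA hx).2 n hnm
  calc (t.card : ℝ≥0∞) * ENNReal.ofReal (ε n ^ (N - r * q))
      = δ⁻¹ * ((t.card * δ) * ENNReal.ofReal (ε n ^ (N - r * q))) := by
        rw [← mul_assoc, mul_left_comm, ENNReal.inv_mul_cancel hδ hδ', mul_one]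
    _ ≤ δ⁻¹ * ((∑ x ∈ t, meanOscillation q u x (ε n)) * ENNReal.ofReal (ε n ^ (N - r * q))) := by
        gcongr
    _ ≤ δ⁻¹ * (oscillationConstant N q r * averagedDifference q r Ω₀ u (2 * ε n)) := by
        refine mul_le_mul_right ?_ _
        exact sum_meanOscillation_mul_le hq (hε n) ht hint hsub
    _ ≤ _ := by gcongr

theorem hausdorffSigmaFinite_liminf_meanOscillation_ne_zero (hΩ : IsOpen Ω) (hq : 1 ≤ q)
    (hrq : r * q ≤ N) (hu : MemLqLoc q Ω u)
    (h : ∀ Ω₀ : Set (EuclideanSpace ℝ (Fin N)), IsOpen Ω₀ → CompactlyInside Ω₀ Ω →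
      limsup (fun ε : ℝ => averagedDifference q r Ω₀ u ε) (𝓝[>] 0) < ∞)
    {ε : ℕ → ℝ} (hε : ∀ n, 0 < ε n) (hlim : Tendsto ε atTop (𝓝 0)) :
    HausdorffSigmaFinite (N - r * q)
      {x ∈ Ω | liminf (fun n => meanOscillation q u x (ε n)) atTop ≠ 0} := by
  have : LocallyCompactSpace Ω := hΩ.locallyCompactSpace
  obtain ⟨K, hK, hKΩ⟩ : IsSigmaCompact Ω := isSigmaCompact_iff_sigmaCompactSpace.2 inferInstance
  have hsub : ∀ j, K j ⊆ Ω := fun j => hKΩ ▸ subset_iUnion K j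
  -- The indices are the compact piece, the level and the starting index; the shift by one keeps the
  -- level finite, since `0⁻¹ = ∞`.
  refine (hausdorffSigmaFinite_iUnion (ι := ℕ × ℕ × ℕ) fun i =>
    hausdorffMeasure_meanOscillation_ge_lt_top hΩ hq hrq hu h hε hlim (hK i.1) (hsub i.1)
      (δ := ((i.2.1 + 1 : ℕ) : ℝ≥0∞)⁻¹) (by simp) (by simp) i.2.2).mono ?_
  rintro x ⟨hx, hne⟩
  obtain ⟨j, hj⟩ := mem_iUnion.1 (hKΩ.symm ▸ hx)
  obtain ⟨k, hk⟩ := ENNReal.exists_inv_nat_lt hne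
  have hk' : ((k + 1 : ℕ) : ℝ≥0∞)⁻¹ < liminf (fun n => meanOscillation q u x (ε n)) atTop :=
    lt_of_le_of_lt (by gcongr; omega) hk
  obtain ⟨m, hm⟩ := eventually_atTop.1 (eventually_lt_of_lt_liminf hk')
  exact mem_iUnion.2 ⟨(j, k, m), hj, fun n hn => (hm n hn).le⟩

theorem MemBVqLoc.limsup_averagedDifference_lt_top (hq : 1 ≤ q) (hu : MemBVqLoc q Ω u)
    (Ω₀ : Set (EuclideanSpace ℝ (Fin N))) (hΩ₀ : IsOpen Ω₀) (hin : CompactlyInside Ω₀ Ω) :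
    limsup (fun ε : ℝ => averagedDifference q (1 / q) Ω₀ u ε) (𝓝[>] 0) < ∞ :=
  _root_.limsup_averagedDifference_lt_top hq hΩ₀ (hu.2 Ω₀ hΩ₀ hin).2

theorem MemBVqLoc.hausdorffSigmaFinite (hΩ : IsOpen Ω) (hN : 1 ≤ N) (hq : 1 ≤ q)
    (hu : MemBVqLoc q Ω u) {ε : ℕ → ℝ} (hε : ∀ n, 0 < ε n) (hlim : Tendsto ε atTop (𝓝 0)) :
    HausdorffSigmaFinite (N - 1)
      {x ∈ Ω | liminf (fun n => meanOscillation q u x (ε n)) atTop ≠ 0} := by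
  have h1 : 1 / q * q = 1 := one_div_mul_cancel (by linarith)
  have := hausdorffSigmaFinite_liminf_meanOscillation_ne_zero (r := 1 / q) hΩ hq
    (by rw [h1]; exact_mod_cast hN) hu.1 (hu.limsup_averagedDifference_lt_top hq) hε hlim
  rwa [h1] at this

/-! ### The restricted discontinuity set. -/

theorem liminf_nhdsGT_le_liminf_atTop (f : ℝ → ℝ≥0∞) {ε : ℕ → ℝ} (hε : ∀ n, 0 < ε n)
    (hlim : Tendsto ε atTop (𝓝 0)) :
    liminf f (𝓝[>] 0) ≤ liminf (fun n => f (ε n)) atTop := by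
  have h : Tendsto ε atTop (𝓝[>] 0) :=
    tendsto_nhdsWithin_iff.2 ⟨hlim, Eventually.of_forall hε⟩
  exact liminf_le_liminf_of_le h

/-- Take `c` to be the mean of `u` on the ball and compare the `L^1` and `L^q` norms for the
normalized measure. -/
theorem iInf_laverage_rpow_le_meanOscillation (hq : 1 ≤ q) {x : EuclideanSpace ℝ (Fin N)} {ρ : ℝ}
    (hρ : 0 < ρ) (hu : IntegrableOn u (ball x ρ)) :
    (⨅ c : EuclideanSpace ℝ (Fin d), ⨍⁻ y in ball x ρ, ‖u y - c‖ₑ ∂volume) ^ q ≤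
      meanOscillation q u x ρ := by
  have hq0 : 0 < q := by linarith
  set P : Measure (EuclideanSpace ℝ (Fin N)) :=
    ((volume.restrict (ball x ρ)) univ)⁻¹ • volume.restrict (ball x ρ) with hP
  have : IsFiniteMeasure (volume.restrict (ball x ρ)) := ⟨by simpa using measure_ball_lt_top⟩
  have : NeZero (volume.restrict (ball x ρ)) :=
    ⟨by simpa [Measure.restrict_eq_zero] using (measure_ball_pos volume x hρ).ne'⟩
  have : IsProbabilityMeasure P := by rw [hP]; infer_instance
  set c := ⨍ w in ball x ρ, u w with hc
  have huP : AEStronglyMeasurable (fun y => u y - c) P :=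
    (hu.aestronglyMeasurable.mono_ac Measure.smul_absolutelyContinuous).sub
      aestronglyMeasurable_const
  have h1 : (⨍⁻ y in ball x ρ, ‖u y - c‖ₑ ∂volume) = eLpNorm' (fun y => u y - c) 1 P := by
    simp [laverage_eq', eLpNorm', hP]
  calc _ ≤ (eLpNorm' (fun y => u y - c) 1 P) ^ q := by
        gcongr
        exact (iInf_le _ c).trans_eq h1
    _ ≤ (eLpNorm' (fun y => u y - c) q P) ^ q := by
        gcongr
        exact eLpNorm'_le_eLpNorm'_of_exponent_le one_pos hq P huP
    _ = _ := by
        rw [← lintegral_rpow_enorm_eq_rpow_eLpNorm' hq0, meanOscillation, laverage_eq']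

theorem restrictedDiscontinuitySet_subset (hΩ : IsOpen Ω) (hq : 1 ≤ q) (hu : MemLqLoc q Ω u)
    {ε : ℕ → ℝ} (hε : ∀ n, 0 < ε n) (hlim : Tendsto ε atTop (𝓝 0)) :
    restrictedDiscontinuitySet Ω u ⊆
      {x ∈ Ω | liminf (fun n => meanOscillation q u x (ε n)) atTop ≠ 0} := by
  rintro x ⟨hx, hne⟩
  refine ⟨hx, fun h0 => hne ?_⟩
  have hq0 : 0 < q := by linarith
  obtain ⟨η, hη, hball⟩ := nhds_basis_closedBall.mem_iff.1 (hΩ.mem_nhds hx)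
  have hle := nonpos_iff_eq_zero.1 ((liminf_nhdsGT_le_liminf_atTop
    (fun ρ => meanOscillation q u x ρ) hε hlim).trans_eq h0)
  refine nonpos_iff_eq_zero.1 (le_of_forall_gt fun a ha => ?_)
  obtain ⟨b, hb0, hba⟩ := exists_between ha
  -- The threshold `b ^ q` becomes `b` once the `q`-th root is taken.
  have hfreq : ∃ᶠ ρ in 𝓝[>] (0 : ℝ), meanOscillation q u x ρ < b ^ q := by
    refine frequently_lt_of_liminf_lt (by isBoundedDefault) ?_
    rw [hle]
    exact ENNReal.rpow_pos_of_nonneg hb0 hq0.le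
  refine lt_of_le_of_lt (liminf_le_of_frequently_le'
    ((hfreq.and_eventually (Ioo_mem_nhdsGT hη)).mono ?_)) hba
  rintro ρ ⟨hρ, hρη⟩
  have hint : IntegrableOn u (ball x ρ) :=
    (hu.integrableOn hq (isCompact_closedBall x η) hball).mono_set
      (ball_subset_closedBall.trans (closedBall_subset_closedBall hρη.2.le))
  exact (ENNReal.rpow_le_rpow_iff hq0).1
    ((iInf_laverage_rpow_le_meanOscillation hq hρη.1 hint).trans hρ.le)

/-- Shrinking `ρ` slightly to `ρ'` preserves the strict inequality, by continuity of the volume. For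
`y` within `ρ - ρ'` of `x`, the ball of radius `ρ'` about `y` lies in `ball x ρ`, so its integral is
no larger. -/
theorem isOpen_setOf_exists_lintegral_ball_lt {F : Type*} (f : F → EuclideanSpace ℝ (Fin N) → ℝ≥0∞)
    {δ : ℝ≥0∞} (hδ : δ ≠ ∞) (η : ℝ) :
    IsOpen {x | ∃ ρ ∈ Ioo 0 η, ∃ c, ∫⁻ y in ball x ρ, f c y <
      δ * volume (ball (0 : EuclideanSpace ℝ (Fin N)) ρ)} := by
  rw [Metric.isOpen_iff]
  rintro x ⟨ρ, hρ, c, hc⟩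
  have hcont : Tendsto (fun ρ' : ℝ => δ * (ENNReal.ofReal (ρ' ^ N) *
      volume (ball (0 : EuclideanSpace ℝ (Fin N)) 1))) (𝓝[<] ρ)
      (𝓝 (δ * (ENNReal.ofReal (ρ ^ N) * volume (ball (0 : EuclideanSpace ℝ (Fin N)) 1)))) := by
    refine ENNReal.Tendsto.const_mul (ENNReal.Tendsto.mul_const ?_ ?_) (Or.inr hδ)
    · exact ENNReal.tendsto_ofReal (((continuous_pow N).tendsto ρ).mono_left nhdsWithin_le_nhds)
    · exact Or.inr measure_ball_lt_top.ne
  rw [volume_ball_pos_euclidean 0 hρ.1] at hc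
  obtain ⟨ρ', hρ', hρ'0⟩ := ((hcont.eventually (lt_mem_nhds hc)).and
    (Ioo_mem_nhdsLT hρ.1)).exists
  refine ⟨ρ - ρ', sub_pos.2 hρ'0.2, fun y hy => ⟨ρ', ⟨hρ'0.1, hρ'0.2.trans hρ.2⟩, c, ?_⟩⟩
  rw [volume_ball_pos_euclidean 0 hρ'0.1]
  refine lt_of_le_of_lt (lintegral_mono_set (ball_subset_ball' ?_)) hρ'
  linarith [mem_ball.1 hy]

theorem measurableSet_restrictedDiscontinuitySet (hΩ : IsOpen Ω) :
    MeasurableSet (restrictedDiscontinuitySet Ω u) := by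
  let O : ℕ → ℕ → Set (EuclideanSpace ℝ (Fin N)) := fun k m =>
    {x | ∃ ρ ∈ Ioo (0 : ℝ) ((m : ℝ) + 1)⁻¹, ∃ c : EuclideanSpace ℝ (Fin d),
      ∫⁻ y in ball x ρ, ‖u y - c‖ₑ <
        ((k + 1 : ℕ) : ℝ≥0∞)⁻¹ * volume (ball (0 : EuclideanSpace ℝ (Fin N)) ρ)}
  have hO : ∀ k m, MeasurableSet (O k m) := fun k m =>
    (isOpen_setOf_exists_lintegral_ball_lt (fun c y => ‖u y - c‖ₑ) (by simp) _).measurableSet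
  have hlt : ∀ (x : EuclideanSpace ℝ (Fin N)) (ρ : ℝ), 0 < ρ → ∀ δ : ℝ≥0∞,
      (⨅ c : EuclideanSpace ℝ (Fin d), ⨍⁻ y in ball x ρ, ‖u y - c‖ₑ ∂volume) < δ ↔
        ∃ c : EuclideanSpace ℝ (Fin d), ∫⁻ y in ball x ρ, ‖u y - c‖ₑ <
          δ * volume (ball (0 : EuclideanSpace ℝ (Fin N)) ρ) := by
    intro x ρ hρ δ
    rw [iInf_lt_iff]
    refine exists_congr fun c => ?_
    rw [setLAverage_eq, Measure.addHaar_ball_center, ENNReal.div_lt_iff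
      (Or.inl (measure_ball_pos volume _ hρ).ne') (Or.inl measure_ball_lt_top.ne)]
  -- A zero liminf means values below every `1 / (k + 1)` at radii below every `1 / (m + 1)`: a
  -- countable intersection of open sets.
  have heq : restrictedDiscontinuitySet Ω u = Ω \ ⋂ k, ⋂ m, O k m := by
    ext x
    refine and_congr_right fun _ => not_congr ?_
    simp only [mem_iInter]
    constructor
    · intro h0 k m
      have hfreq := frequently_lt_of_liminf_lt (by isBoundedDefault)
        (h0.trans_lt (ENNReal.inv_pos.2 (ENNReal.natCast_ne_top (k + 1))))
      obtain ⟨ρ, hρ, hρm⟩ := (hfreq.and_eventually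
        (Ioo_mem_nhdsGT (by positivity : (0 : ℝ) < ((m : ℝ) + 1)⁻¹))).exists
      exact ⟨ρ, hρm, (hlt x ρ hρm.1 _).1 hρ⟩
    · intro h
      refine nonpos_iff_eq_zero.1 (le_of_forall_gt fun a ha => ?_)
      obtain ⟨k, hk⟩ := ENNReal.exists_inv_nat_lt ha.ne'
      refine lt_of_le_of_lt (liminf_le_of_frequently_le' ?_) hk
      refine (nhdsGT_basis (0 : ℝ)).frequently_iff.2 fun η hη => ?_
      obtain ⟨m, hm⟩ := exists_nat_one_div_lt hη
      obtain ⟨ρ, hρ, hc⟩ := h k m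
      rw [one_div] at hm
      refine ⟨ρ, ⟨hρ.1, hρ.2.trans hm⟩, ((hlt x ρ hρ.1 _).2 hc).le.trans ?_⟩
      gcongr
      omega
  rw [heq]
  exact hΩ.measurableSet.diff (MeasurableSet.iInter fun k => MeasurableSet.iInter fun m => hO k m)

end SigmaFinite

theorem mainTheorem2 (N d : ℕ) (hN : 1 ≤ N) (Ω : Set (EuclideanSpace ℝ (Fin N)))
    (hΩ : IsOpen Ω) (q : ℝ) (hq : 1 ≤ q)
    (u : EuclideanSpace ℝ (Fin N) → EuclideanSpace ℝ (Fin d)) :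
    (∀ r : ℝ, 0 < r → r * q ≤ N → MemLqLoc q Ω u →
      (∀ Ω₀ : Set (EuclideanSpace ℝ (Fin N)), IsOpen Ω₀ → CompactlyInside Ω₀ Ω →
        limsup (fun ε : ℝ => averagedDifference q r Ω₀ u ε) (𝓝[>] 0) < ∞) →
      ∀ ε : ℕ → ℝ, (∀ n, 0 < ε n) → Tendsto ε atTop (𝓝 0) →
        ∃ S : Set (EuclideanSpace ℝ (Fin N)), S ⊆ Ω ∧ HausdorffSigmaFinite (N - r * q) S ∧
          ∀ x ∈ Ω \ S, liminf (fun n => meanOscillation q u x (ε n)) atTop = 0) ∧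
    (MemBVqLoc q Ω u →
      (∀ ε : ℕ → ℝ, (∀ n, 0 < ε n) → Tendsto ε atTop (𝓝 0) →
        ∃ S : Set (EuclideanSpace ℝ (Fin N)), S ⊆ Ω ∧ HausdorffSigmaFinite (N - 1) S ∧
          ∀ x ∈ Ω \ S, liminf (fun n => meanOscillation q u x (ε n)) atTop = 0) ∧
      (∃ S : Set (EuclideanSpace ℝ (Fin N)), MeasurableSet S ∧ HausdorffSigmaFinite (N - 1) S ∧
        ∀ᵐ x ∂(Measure.hausdorffMeasure ((N : ℝ) - 1) : Measure (EuclideanSpace ℝ (Fin N))),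
          x ∈ Ω \ S → liminf (fun ρ : ℝ => meanOscillation q u x ρ) (𝓝[>] 0) = 0) ∧
      MeasurableSet (restrictedDiscontinuitySet Ω u) ∧
      HausdorffSigmaFinite (N - 1) (restrictedDiscontinuitySet Ω u)) := by
  refine ⟨fun r _ hrq hu h ε hε hlim => ?_, fun hu => ⟨fun ε hε hlim => ?_, ?_, ?_, ?_⟩⟩
  · exact ⟨_, sep_subset _ _,
      hausdorffSigmaFinite_liminf_meanOscillation_ne_zero hΩ hq hrq hu h hε hlim,
      fun x hx => by_contra fun hne => hx.2 ⟨hx.1, hne⟩⟩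
  · exact ⟨_, sep_subset _ _, hu.hausdorffSigmaFinite hΩ hN hq hε hlim,
      fun x hx => by_contra fun hne => hx.2 ⟨hx.1, hne⟩⟩
  · have hε : ∀ n : ℕ, 0 < 1 / ((n : ℝ) + 1) := fun n => by positivity
    have hlim := tendsto_one_div_add_atTop_nhds_zero_nat (𝕜 := ℝ)
    obtain ⟨T, hST, hTm, hT⟩ :=
      (hu.hausdorffSigmaFinite hΩ hN hq hε hlim).exists_measurable_superset
    -- Enlarging to the Borel hull `T` loses nothing; the conclusion holds at every point of `Ω \
    -- T`, not merely almost everywhere.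
    refine ⟨T, hTm, hT, Eventually.of_forall fun x hx => nonpos_iff_eq_zero.1 ?_⟩
    refine (liminf_nhdsGT_le_liminf_atTop _ hε hlim).trans_eq ?_
    exact by_contra fun hne => hx.2 (hST ⟨hx.1, hne⟩)
  · exact measurableSet_restrictedDiscontinuitySet hΩ
  · have hε : ∀ n : ℕ, 0 < 1 / ((n : ℝ) + 1) := fun n => by positivity
    have hlim := tendsto_one_div_add_atTop_nhds_zero_nat (𝕜 := ℝ)
    exact (hu.hausdorffSigmaFinite hΩ hN hq hε hlim).mono
      (restrictedDiscontinuitySet_subset hΩ hq hu.1 hε hlim)
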